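/- Let $F_n$ be the free group of rank $n$, $\mathrm{Aut}(F_n)$ its automorphism group and $\mathrm{Out}(F_n)=\mathrm{Aut}(F_n)/\mathrm{Inn}(F_n)$ its outer automorphism group. Let $\mathrm{Diff}^2_+(S^1)$ and $\mathrm{Diff}^2_+(I)$ denote the groups of orientation-preserving $C^2$ diffeomorphisms of the circle $S^1$ and of the interval $I=[0,1]$. Let $n\ge 6$. Then: 1. every homomorphism $\phi:\mathrm{Aut}(F_n)\to \mathrm{Diff}^2_+(S^1)$ factors through $\mathbb{Z}/2\mathbb{Z}$, i.e. $\phi=\psi\circ\pi$ for some homomorphisms $\pi:\mathrm{Aut}(F_n)\to\mathbb{Z}/2\mathbb{Z}$ and $\psi:\mathbb{Z}/2\mathbb{Z}\to\mathrm{Diff}^2_+(S^1)$; 2. every homomorphism $\mathrm{Aut}(F_n)\to\mathrm{Diff}^2_+(I)$ is trivial; 3. every homomorphism $\mathrm{Out}(F_n)\to \mathrm{Diff}^2_+(S^1)$ factors through $\mathbb{Z}/2\mathbb{Z}$ in the same sense; 4. every homomorphism $\mathrm{Out}(F_n)\to\mathrm{Diff}^2_+(I)$ is trivial. -/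

import Mathlib

open scoped Manifold ContDiff

/-- The group `Diff^r(M)` of `C^r` diffeomorphisms of a manifold `M` (modelled on `I`), as a
subgroup of the group of all bijections `M → M`: the bijections that are `C^r` together with
their inverse. The group law is composition. -/
def diffGroup {E H : Type*} [NormedAddCommGroup E] [NormedSpace ℝ E] [TopologicalSpace H]
    (I : ModelWithCorners ℝ E H) (r : ℕ∞) (M : Type*) [TopologicalSpace M] [ChartedSpace H M] :
    Subgroup (Equiv.Perm M) where
  carrier := {f | ContMDiff I I r f ∧ ContMDiff I I r f.symm}
  one_mem' := ⟨contMDiff_id, contMDiff_id⟩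
  mul_mem' := fun hf hg => ⟨hf.1.comp hg.1, hg.2.comp hf.2⟩
  inv_mem' := fun hf => ⟨hf.2, hf.1⟩

/-- The orientation-preserving bijections of the circle, as a subgroup of all bijections of the unit circle:
`f` preserves orientation if it lifts, under the universal covering `t ↦ exp (i t)`, to an
increasing bijection of the line. -/
def orientationPreservingCircle : Subgroup (Equiv.Perm Circle) where
  carrier := {f | ∃ F : ℝ ≃o ℝ, ∀ t : ℝ, f (Circle.exp t) = Circle.exp (F t)}
  one_mem' := ⟨OrderIso.refl ℝ, fun _ => rfl⟩
  mul_mem' := by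
    rintro f g ⟨F, hF⟩ ⟨G, hG⟩
    exact ⟨G.trans F, fun t => by simp [hF, hG]⟩
  inv_mem' := by
    rintro f ⟨F, hF⟩
    refine ⟨F.symm, fun t => ?_⟩
    rw [Equiv.Perm.inv_eq_iff_eq, hF, OrderIso.apply_symm_apply]

/-- The increasing bijections of the interval `[0, 1]`, as a subgroup of all bijections. -/
def orientationPreservingInterval : Subgroup (Equiv.Perm (Set.Icc (0 : ℝ) 1)) where
  carrier := {f | StrictMono f}
  one_mem' := strictMono_id
  mul_mem' := fun {f g} (hf : StrictMono f) (hg : StrictMono g) => hf.comp hg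
  inv_mem' := by
    intro f hf x y hxy
    have hf' : StrictMono f := hf
    rw [← hf'.lt_iff_lt]
    simpa using hxy

/-- `Diff₊^r(S¹)`: orientation-preserving `C^r` diffeomorphisms of the circle. -/
noncomputable def DiffCircle (r : ℕ∞) : Subgroup (Equiv.Perm Circle) :=
  diffGroup (𝓡 1) r Circle ⊓ orientationPreservingCircle

/-- `Diff₊^r(I)`: orientation-preserving `C^r` diffeomorphisms of `I = [0, 1]`, where smoothness
is up to the boundary. -/
noncomputable def DiffInterval (r : ℕ∞) : Subgroup (Equiv.Perm (Set.Icc (0 : ℝ) 1)) :=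
  diffGroup (𝓡∂ 1) r (Set.Icc (0 : ℝ) 1) ⊓ orientationPreservingInterval

instance innerAut_normal (G : Type*) [Group G] : (MulAut.conj (G := G)).range.Normal where
  conj_mem := by
    rintro _ ⟨g, rfl⟩ φ
    refine ⟨φ g, ?_⟩
    ext x
    simp [MulAut.conj_apply]

/-- `Out(G)`: the automorphism group of `G` modulo the inner automorphisms. -/
abbrev OutAut (G : Type*) [Group G] : Type _ := MulAut G ⧸ (MulAut.conj (G := G)).range

/-- The homomorphism `φ` factors through `ℤ/2ℤ` (written multiplicatively):
it is a composition `G → ℤ/2ℤ → K` of homomorphisms. -/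
def FactorsThroughZModTwo {G K : Type*} [Group G] [Group K] (φ : G →* K) : Prop :=
  ∃ (π : G →* Multiplicative (ZMod 2)) (ψ : Multiplicative (ZMod 2) →* K), φ = ψ.comp π

/-! An increasing bijection of a line whose square is the identity is the identity. On the circle, a
nontrivial orientation-preserving involution lifts to a square root of the deck translation, and
commuting involutions have commuting square roots, which must coincide. So in both target groups two
commuting nontrivial involutions are equal (`CommutingInvolutionsAgree`).

This alone is what makes the maps rigid. The sign changes of the generators commute and are
conjugate, so all have the same image `ε`. With a third generator available, `ε` commutes with the
image of every transvection and also inverts it, so these images are involutions; a commutator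
relation then makes them trivial, and swaps map to `ε`. By Nielsen's theorem these elements
generate, so the image is contained in `{1, ε}`.

Nielsen's theorem is proved by minimising a weight on bases: a minimal basis is Nielsen reduced, and
then contains every generator up to inversion. -/

/-- In `G`, any two distinct commuting nontrivial involutions coincide. -/
def CommutingInvolutionsAgree (G : Type*) [Group G] : Prop :=
  ∀ a b : G, a * a = 1 → b * b = 1 → a * b = b * a → a = 1 ∨ b = 1 ∨ a = b

/-! ### Involutions of ordered sets, of the circle and of the interval -/

theorem StrictMono.eq_self_of_apply_apply {α : Type*} [LinearOrder α] {f : α → α}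
    (hf : StrictMono f) (h : ∀ x, f (f x) = x) (x : α) : f x = x := by
  rcases lt_trichotomy (f x) x with hx | hx | hx
  · exact absurd ((h x).symm.trans_lt (hf hx)) (lt_asymm hx)
  · exact hx
  · exact absurd ((hf hx).trans_eq (h x)) (lt_asymm hx)

theorem OrderIso.eq_one_of_mul_self {α : Type*} [LinearOrder α] {f : α ≃o α} (h : f * f = 1) :
    f = 1 := by
  ext x
  exact f.strictMono.eq_self_of_apply_apply (fun y => DFunLike.congr_fun h y) x

/-- The translation of the line by `2π`, which generates the deck transformations of the circle. -/
noncomputable def deckTranslation : ℝ ≃o ℝ := OrderIso.addRight (2 * Real.pi)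

theorem deckTranslation_zpow_apply (k : ℤ) (t : ℝ) :
    (deckTranslation ^ k) t = t + k * (2 * Real.pi) := by
  have hs : ∀ s : ℝ, deckTranslation s = s + 2 * Real.pi := fun s => rfl
  have hi : ∀ s : ℝ, deckTranslation⁻¹ s = s - 2 * Real.pi := fun s => by
    rw [show deckTranslation⁻¹ = deckTranslation.symm from rfl, OrderIso.symm_apply_eq, hs]
    ring
  induction k generalizing t with
  | zero => simp
  | succ k ih => rw [zpow_add_one, RelIso.mul_apply, ih, hs]; push_cast; ring
  | pred k ih => rw [zpow_sub_one, RelIso.mul_apply, ih, hi]; push_cast; ring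

theorem deckTranslation_zpow_injective :
    Function.Injective fun k : ℤ => deckTranslation ^ k := by
  intro k l h
  have h0 := DFunLike.congr_fun h (0 : ℝ)
  simp only [deckTranslation_zpow_apply, zero_add] at h0
  exact_mod_cast mul_right_cancel₀ (by positivity) h0

/-- `F` is a lift of the map `f` of the circle to the line. -/
def IsCircleLift (F : ℝ ≃o ℝ) (f : Equiv.Perm Circle) : Prop :=
  ∀ t : ℝ, f (Circle.exp t) = Circle.exp (F t)

namespace IsCircleLift

variable {F G : ℝ ≃o ℝ} {f g : Equiv.Perm Circle}

theorem mul (hF : IsCircleLift F f) (hG : IsCircleLift G g) : IsCircleLift (F * G) (f * g) :=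
  fun t => by rw [Equiv.Perm.mul_apply, hG, hF]; rfl

theorem inv (hF : IsCircleLift F f) : IsCircleLift F⁻¹ f⁻¹ := fun t => by
  rw [Equiv.Perm.inv_eq_iff_eq, hF]
  exact congrArg _ (F.apply_symm_apply t).symm

theorem deckTranslation_zpow (k : ℤ) : IsCircleLift (deckTranslation ^ k) 1 := fun t => by
  rw [deckTranslation_zpow_apply]
  exact Circle.exp_eq_exp.2 ⟨-k, by push_cast; ring⟩

theorem unique (hF : IsCircleLift F f) (hG : IsCircleLift F g) : f = g := by
  ext1 z
  obtain ⟨t, rfl⟩ := Circle.exp_surjective z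
  rw [hF, hG]

/-- `F t - t` is continuous with values in the discrete set `2πℤ`, hence constant. -/
theorem exists_eq_zpow (hF : IsCircleLift F 1) : ∃ k : ℤ, F = deckTranslation ^ k := by
  have h : ∀ t, ∃ k : ℤ, F t = t + k * (2 * Real.pi) := fun t =>
    Circle.exp_eq_exp.1 (hF t).symm
  choose k hk using h
  have hπ : (2 * Real.pi) ≠ 0 := by positivity
  have hcont : Continuous fun t => ((k t : ℤ) : ℝ) := by
    have : (fun t => ((k t : ℤ) : ℝ)) = fun t => (F t - t) / (2 * Real.pi) := by
      ext t
      rw [hk t]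
      field_simp
      ring
    rw [this]
    exact (F.continuous.sub continuous_id).div_const _
  have hcont' : Continuous k := Int.isClosedEmbedding_coe_real.isInducing.continuous_iff.2 hcont
  refine ⟨k 0, ?_⟩
  ext t
  rw [deckTranslation_zpow_apply, hk t, PreconnectedSpace.constant inferInstance hcont' (x := t)]

/-- Conjugation by `F` and by `F⁻¹` sends the translation to powers whose exponents are inverse
integers; the sign is positive because `F` is increasing. -/
theorem commute_deckTranslation (hF : IsCircleLift F f) :
    F * deckTranslation * F⁻¹ = deckTranslation := by
  have key : ∀ {E : ℝ ≃o ℝ} {e : Equiv.Perm Circle}, IsCircleLift E e →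
      ∃ k : ℤ, E * deckTranslation * E⁻¹ = deckTranslation ^ k := fun {E e} hE => by
    apply exists_eq_zpow
    simpa using (hE.mul (deckTranslation_zpow 1)).mul hE.inv
  obtain ⟨k, hk⟩ := key hF
  obtain ⟨l, hl⟩ := key hF.inv
  have hkl : deckTranslation ^ (l * k) = deckTranslation ^ (1 : ℤ) := by
    rw [zpow_mul, ← hl, conj_zpow, ← hk]
    group
  have hkl' : l * k = 1 := deckTranslation_zpow_injective hkl
  have hpos : 0 < k := by
    have h1 : (F * deckTranslation * F⁻¹) 0 > 0 := by
      have h2 : F (F⁻¹ 0) = 0 := F.apply_symm_apply 0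
      have h3 : F (F⁻¹ 0 + 2 * Real.pi) > F (F⁻¹ 0) := F.strictMono (by
        have := Real.pi_pos
        linarith)
      rw [h2] at h3
      exact h3
    rw [hk, deckTranslation_zpow_apply, zero_add] at h1
    have := pos_of_mul_pos_left h1 (by positivity)
    exact_mod_cast this
  have : k = 1 := by
    rcases Int.eq_one_or_neg_one_of_mul_eq_one' hkl' with ⟨-, h⟩ | ⟨-, h⟩ <;> omega
  rw [hk, this, zpow_one]

/-- The square of a lift is a deck translation with exponent `m`, and changing the lift shifts `m`
by even numbers. If `m` were even, some lift would be an involution of the line, so `f = 1`; hence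
`m` can be made `1`. -/
theorem exists_mul_self_eq (hF : IsCircleLift F f) (hf : f * f = 1) (hf1 : f ≠ 1) :
    ∃ F' : ℝ ≃o ℝ, IsCircleLift F' f ∧ F' * F' = deckTranslation := by
  obtain ⟨m, hm⟩ := exists_eq_zpow (hf ▸ hF.mul hF)
  have hcomm : Commute F deckTranslation := by
    have := hF.commute_deckTranslation
    rwa [mul_inv_eq_iff_eq_mul] at this
  have hsq : ∀ j : ℤ, (F * deckTranslation ^ j) * (F * deckTranslation ^ j) =
      deckTranslation ^ (m + 2 * j) := fun j => by
    rw [(hcomm.zpow_right j).symm.mul_mul_mul_comm, hm, ← zpow_add, ← zpow_add]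
    congr 1
    ring
  have hlift : ∀ j : ℤ, IsCircleLift (F * deckTranslation ^ j) f := fun j => by
    simpa using hF.mul (deckTranslation_zpow j)
  obtain ⟨j, hj⟩ | ⟨j, hj⟩ := Int.even_or_odd m
  · refine absurd ?_ hf1
    have h1 := OrderIso.eq_one_of_mul_self ((hsq (-j)).trans (by rw [hj]; simp [two_mul]))
    have := hlift (-j)
    rw [h1] at this
    exact this.unique (by simpa using deckTranslation_zpow 0)
  · exact ⟨_, hlift (-j), (hsq (-j)).trans (by rw [hj]; simp)⟩

end IsCircleLift

theorem commutingInvolutionsAgree_orientationPreservingCircle :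
    CommutingInvolutionsAgree orientationPreservingCircle := by
  rintro ⟨f, F₀, hF₀⟩ ⟨g, G₀, hG₀⟩ hf hg hfg
  simp only [Subtype.ext_iff, Subgroup.coe_mul, Subgroup.coe_one] at hf hg hfg ⊢
  by_cases hf1 : f = 1
  · exact Or.inl hf1
  by_cases hg1 : g = 1
  · exact Or.inr (Or.inl hg1)
  right; right
  obtain ⟨F, hF, hF2⟩ := IsCircleLift.exists_mul_self_eq hF₀ hf hf1
  obtain ⟨G, hG, hG2⟩ := IsCircleLift.exists_mul_self_eq hG₀ hg hg1
  have hTG : Commute deckTranslation G := by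
    have := hG.commute_deckTranslation
    rw [mul_inv_eq_iff_eq_mul] at this
    exact Eq.symm this
  obtain ⟨k, hk⟩ : ∃ k : ℤ, F * G * F⁻¹ * G⁻¹ = deckTranslation ^ k := by
    apply IsCircleLift.exists_eq_zpow
    have := ((hF.mul hG).mul hF.inv).mul hG.inv
    rwa [hfg, mul_inv_cancel_right, mul_inv_cancel] at this
  have hconj : F * G * F⁻¹ = deckTranslation ^ k * G := by rw [← hk]; group
  -- Both sides are the square of `F * G * F⁻¹`; comparing exponents forces `k = 0`, so the square
  -- roots `F` and `G` commute.
  have hsq : deckTranslation ^ (1 : ℤ) = deckTranslation ^ (2 * k + 1) := by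
    calc deckTranslation ^ (1 : ℤ) = F * deckTranslation * F⁻¹ := by
          rw [hF.commute_deckTranslation, zpow_one]
      _ = (F * G * F⁻¹) * (F * G * F⁻¹) := by rw [← hG2]; group
      _ = deckTranslation ^ (2 * k + 1) := by
          rw [hconj, (hTG.zpow_left k).symm.mul_mul_mul_comm, hG2, ← zpow_add,
            ← zpow_add_one, two_mul]
  have hk0 : k = 0 := by
    have := deckTranslation_zpow_injective hsq
    omega
  have hcomm : Commute F G := by
    rw [hk0, zpow_zero, one_mul, mul_inv_eq_iff_eq_mul] at hconj
    exact hconj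
  have h1 : F * G⁻¹ = 1 := OrderIso.eq_one_of_mul_self (by
    rw [(hcomm.inv_right).symm.mul_mul_mul_comm, hF2, ← mul_inv_rev, hG2, mul_inv_cancel])
  rw [mul_inv_eq_one] at h1
  exact hF.unique (h1 ▸ hG)

theorem CommutingInvolutionsAgree.of_injective {G K : Type*} [Group G] [Group K]
    (hK : CommutingInvolutionsAgree K) (ι : G →* K) (hι : Function.Injective ι) :
    CommutingInvolutionsAgree G := by
  intro a b ha hb hab
  have := hK (ι a) (ι b) (by rw [← map_mul, ha, map_one]) (by rw [← map_mul, hb, map_one])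
    (by rw [← map_mul, hab, map_mul])
  simpa [map_eq_one_iff ι hι, hι.eq_iff] using this

theorem commutingInvolutionsAgree_diffCircle (r : ℕ∞) :
    CommutingInvolutionsAgree (DiffCircle r) :=
  commutingInvolutionsAgree_orientationPreservingCircle.of_injective
    (Subgroup.inclusion inf_le_right) (Subgroup.inclusion_injective _)

theorem DiffInterval.eq_one_of_mul_self {r : ℕ∞} {f : DiffInterval r} (h : f * f = 1) : f = 1 := by
  have hf : StrictMono (f : Equiv.Perm (Set.Icc (0 : ℝ) 1)) := f.2.2
  ext1
  ext1 x
  exact hf.eq_self_of_apply_apply (fun y => DFunLike.congr_fun (congrArg Subtype.val h) y) x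

theorem commutingInvolutionsAgree_diffInterval (r : ℕ∞) :
    CommutingInvolutionsAgree (DiffInterval r) :=
  fun _ _ ha _ _ => Or.inl (DiffInterval.eq_one_of_mul_self ha)

/-! ### Common prefixes of words -/

section CommonPrefix

variable {β : Type*} [DecidableEq β]

/-- The length of the longest common prefix of two lists. -/
def List.commonPrefixLength : List β → List β → ℕ
  | a :: l, b :: m => if a = b then commonPrefixLength l m + 1 else 0
  | _, _ => 0

namespace List

theorem commonPrefixLength_comm (l m : List β) :
    commonPrefixLength l m = commonPrefixLength m l := by
  induction l generalizing m with
  | nil => cases m <;> rfl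
  | cons a l ih =>
    cases m with
    | nil => rfl
    | cons b m => simp only [commonPrefixLength, ih m, eq_comm]

theorem exists_eq_append_of_commonPrefixLength (l m : List β) :
    ∃ c a b, l = c ++ a ∧ m = c ++ b ∧ c.length = commonPrefixLength l m ∧
      ∀ x ∈ a.head?, ∀ y ∈ b.head?, x ≠ y := by
  induction l generalizing m with
  | nil => exact ⟨[], [], m, rfl, rfl, by cases m <;> rfl, by simp⟩
  | cons x l ih =>
    cases m with
    | nil => exact ⟨[], x :: l, [], rfl, rfl, rfl, by simp⟩
    | cons y m =>
      by_cases h : x = y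
      · obtain ⟨c, a, b, rfl, rfl, hc, hab⟩ := ih m
        subst h
        exact ⟨x :: c, a, b, rfl, rfl, by simp [commonPrefixLength, hc], hab⟩
      · exact ⟨[], x :: l, y :: m, rfl, rfl, by simp [commonPrefixLength, h], by simpa⟩

theorem IsPrefix.length_le_commonPrefixLength {c l m : List β} (hl : c <+: l) (hm : c <+: m) :
    c.length ≤ commonPrefixLength l m := by
  obtain ⟨a, rfl⟩ := hl
  obtain ⟨b, rfl⟩ := hm
  induction c with
  | nil => simp
  | cons x c ih => simpa [commonPrefixLength] using ih

/-- Two prefixes of `m` are comparable, so the shorter one is shared by all three words. This is the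
ultrametric inequality of a tree. -/
theorem min_commonPrefixLength_le (l m k : List β) :
    min (commonPrefixLength l m) (commonPrefixLength m k) ≤ commonPrefixLength l k := by
  obtain ⟨c, a, b, hl, hm, hc, -⟩ := exists_eq_append_of_commonPrefixLength l m
  obtain ⟨c', a', b', hm', hk, hc', -⟩ := exists_eq_append_of_commonPrefixLength m k
  have h1 : c <+: m := ⟨b, hm.symm⟩
  have h2 : c' <+: m := ⟨a', hm'.symm⟩
  have h3 : c <+: l := ⟨a, hl.symm⟩
  have h4 : c' <+: k := ⟨b', hk.symm⟩
  rcases le_total c.length c'.length with h | h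
  · have := h3.length_le_commonPrefixLength ((prefix_of_prefix_length_le h1 h2 h).trans h4)
    omega
  · have := ((prefix_of_prefix_length_le h2 h1 h).trans h3).length_le_commonPrefixLength h4
    omega

end List

end CommonPrefix

/-! ### Cancellation in products and Nielsen reduced sets -/

namespace FreeGroup

variable {α : Type*} [DecidableEq α]

/-- The Gromov product of two elements of a free group: the length of the longest common prefix of
their reduced words. -/
def gromovProduct (x y : FreeGroup α) : ℕ := List.commonPrefixLength x.toWord y.toWord

theorem gromovProduct_comm (x y : FreeGroup α) : gromovProduct x y = gromovProduct y x :=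
  List.commonPrefixLength_comm _ _

theorem min_gromovProduct_le (x y z : FreeGroup α) :
    min (gromovProduct x y) (gromovProduct y z) ≤ gromovProduct x z :=
  List.min_commonPrefixLength_le _ _ _

/-- Exactly the common prefix cancels: the remainders start with different letters, so their
junction is reduced. -/
theorem exists_toWord_inv_mul (x y : FreeGroup α) :
    ∃ c a b, x.toWord = c ++ a ∧ y.toWord = c ++ b ∧ c.length = gromovProduct x y ∧
      (x⁻¹ * y).toWord = invRev a ++ b := by
  obtain ⟨c, a, b, hx, hy, hc, hab⟩ :=
    List.exists_eq_append_of_commonPrefixLength x.toWord y.toWord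
  refine ⟨c, a, b, hx, hy, hc, ?_⟩
  have h1 : x⁻¹ * y = mk (invRev a ++ b) := by
    rw [← mk_toWord (x := x), ← mk_toWord (x := y), hx, hy, ← mul_mk, ← mul_mk, ← mul_mk,
      ← inv_mk]
    group
  rw [h1, toWord_mk, ← isReduced_iff_reduce_eq]
  have ha : IsReduced (invRev a) := by
    have : IsReduced (x⁻¹).toWord := isReduced_toWord
    rw [toWord_inv, hx, invRev_append] at this
    exact this.infix (List.prefix_append _ _).isInfix
  have hb : IsReduced b := by
    have : IsReduced y.toWord := isReduced_toWord
    rw [hy] at this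
    exact this.infix (List.suffix_append _ _).isInfix
  refine List.isChain_append.2 ⟨ha, hb, ?_⟩
  intro p hp q hq hpq
  simp only [invRev, List.getLast?_reverse, List.head?_map, Option.mem_def,
    Option.map_eq_some_iff] at hp
  obtain ⟨p', hp', rfl⟩ := hp
  have hne := hab p' hp' q hq
  by_contra hcon
  exact hne (Prod.ext hpq (by simpa using hcon))

theorem norm_inv_mul_add (x y : FreeGroup α) :
    norm (x⁻¹ * y) + 2 * gromovProduct x y = norm x + norm y := by
  obtain ⟨c, a, b, hx, hy, hc, h⟩ := exists_toWord_inv_mul x y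
  simp only [norm, h, hx, hy, List.length_append, invRev_length, ← hc]
  ring

theorem norm_mul_add (x y : FreeGroup α) :
    norm (x * y) + 2 * gromovProduct x⁻¹ y = norm x + norm y := by
  simpa using norm_inv_mul_add x⁻¹ y

/-- Writing `x` as `u c u⁻¹` with `c` cyclically reduced and nonempty, squaring only doubles `c`. -/
theorem norm_lt_norm_mul_self {x : FreeGroup α} (hx : x ≠ 1) : norm x < norm (x * x) := by
  have hred : IsReduced x.toWord := isReduced_toWord
  have h2 : (x * x).toWord = _ :=
    (toWord_pow x 2 ▸ congrArg toWord (pow_two x).symm).trans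
      (reduceCyclically.reduce_flatten_replicate_succ hred 1)
  have h1 := reduceCyclically.conj_conjugator_reduceCyclically x.toWord
  have hne : reduceCyclically x.toWord ≠ [] := by
    intro h
    apply hx
    rw [h, List.append_nil] at h1
    rw [← mk_toWord (x := x), ← h1, ← mul_mk, ← inv_mk, mul_inv_cancel]
  have hpos := List.length_pos_iff.2 hne
  have h1' := congrArg List.length h1
  simp only [norm, h2]
  simp at h1' ⊢
  omega

theorem two_mul_gromovProduct_inv_self_lt {x : FreeGroup α} (hx : x ≠ 1) :
    2 * gromovProduct x⁻¹ x < norm x := by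
  have := norm_lt_norm_mul_self hx
  have := norm_mul_add x x
  omega

section Reduced

variable {A : Set (FreeGroup α)}

/-- Nielsen reduced sets of elements of a free group. -/
structure IsNielsenReduced (A : Set (FreeGroup α)) : Prop where
  inv_mem : ∀ x ∈ A, x⁻¹ ∈ A
  ne_one : ∀ x ∈ A, x ≠ 1
  norm_le : ∀ x ∈ A, ∀ y ∈ A, x * y ≠ 1 → norm y ≤ norm (x * y)
  gromovProduct_add_lt : ∀ x ∈ A, ∀ y ∈ A, ∀ z ∈ A, x * y ≠ 1 → y * z ≠ 1 →
    gromovProduct x⁻¹ y + gromovProduct y⁻¹ z < norm y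

/-- `ReducedProduct A g y` says that `g` is a product of elements of `A`, no two successive ones
being inverse to each other, and the last one being `y`. -/
inductive ReducedProduct (A : Set (FreeGroup α)) : FreeGroup α → FreeGroup α → Prop
  | single {y} : y ∈ A → ReducedProduct A y y
  | mul {g y z} : ReducedProduct A g y → z ∈ A → y * z ≠ 1 → ReducedProduct A (g * z) z

omit [DecidableEq α] in
theorem ReducedProduct.mem {g y : FreeGroup α} (h : ReducedProduct A g y) : y ∈ A := by
  cases h <;> assumption

theorem ReducedProduct.exists_of_mem_closure (hA : IsNielsenReduced A) {g : FreeGroup α}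
    (hg : g ∈ Subgroup.closure A) : g = 1 ∨ ∃ y, ReducedProduct A g y := by
  have step : ∀ x : FreeGroup α, ∀ z ∈ A, (x = 1 ∨ ∃ y, ReducedProduct A x y) →
      x * z = 1 ∨ ∃ y, ReducedProduct A (x * z) y := by
    rintro x z hz (rfl | ⟨y, hy⟩)
    · exact Or.inr ⟨z, by simpa using .single hz⟩
    · by_cases hyz : y * z = 1
      · cases hy with
        | single hy => exact Or.inl hyz
        | @mul g y' _ hg hy hne =>
          rw [mul_assoc, hyz, mul_one]
          exact Or.inr ⟨y', hg⟩
      · exact Or.inr ⟨z, hy.mul hz hyz⟩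
  induction hg using Subgroup.closure_induction_right with
  | one => exact Or.inl rfl
  | mul_right x hx y hy ih => exact step x y hy ih
  | mul_inv_cancel x hx y hy ih => exact step x _ (hA.inv_mem y hy) ih

theorem IsNielsenReduced.two_mul_gromovProduct_le (hA : IsNielsenReduced A) {x y : FreeGroup α}
    (hx : x ∈ A) (hy : y ∈ A) (hxy : x * y ≠ 1) :
    2 * gromovProduct x⁻¹ y ≤ norm x ∧ 2 * gromovProduct x⁻¹ y ≤ norm y := by
  have h1 := hA.norm_le x hx y hy hxy
  have h2 := hA.norm_le _ (hA.inv_mem y hy) _ (hA.inv_mem x hx)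
    (by rwa [← mul_inv_rev, inv_ne_one])
  have h3 := norm_mul_add x y
  rw [← mul_inv_rev, norm_inv_eq, norm_inv_eq] at h2
  omega

/-- The invariant is that the cancellation with the next factor depends only on the last factor `y`.
Since at most half of each of `y` and `z` cancels, a product of two or more factors keeps length at
least two. -/
theorem ReducedProduct.norm_aux (hA : IsNielsenReduced A) {g y : FreeGroup α}
    (h : ReducedProduct A g y) : (g = y ∨ 2 ≤ norm g) ∧
      ∀ z ∈ A, y * z ≠ 1 → gromovProduct g⁻¹ z = gromovProduct y⁻¹ z := by
  induction h with
  | single hy => exact ⟨Or.inl rfl, fun _ _ _ => rfl⟩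
  | @mul g y z hg hz hyz ih =>
    obtain ⟨ih1, ih2⟩ := ih
    have hy := hg.mem
    have hnorm := norm_mul_add g z
    rw [ih2 z hz hyz] at hnorm
    obtain ⟨hle1, hle2⟩ := hA.two_mul_gromovProduct_le hy hz hyz
    have hz1 : 0 < norm z := Nat.pos_of_ne_zero (mt norm_eq_zero.1 (hA.ne_one z hz))
    have hy1 : 0 < norm y := Nat.pos_of_ne_zero (mt norm_eq_zero.1 (hA.ne_one y hy))
    refine ⟨Or.inr ?_, fun w hw hzw => ?_⟩
    · rcases ih1 with rfl | ih1 <;> omega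
    -- `g * z` ends with the part of `z` surviving cancellation, which by `h2` is longer than what
    -- `w` can cancel; the ultrametric inequality then gives equality.
    · have h1 := norm_mul_add (g * z) z⁻¹
      rw [mul_inv_cancel_right, norm_inv_eq] at h1
      have h2 := hA.gromovProduct_add_lt y hy z hz w hw hyz hzw
      have h3 := min_gromovProduct_le (g * z)⁻¹ z⁻¹ w
      have h4 := min_gromovProduct_le z⁻¹ (g * z)⁻¹ w
      rw [gromovProduct_comm z⁻¹] at h4
      omega

/-- An element of length one of the subgroup generated by a Nielsen reduced set belongs to it. -/
theorem IsNielsenReduced.mem_of_norm_eq_one (hA : IsNielsenReduced A) {g : FreeGroup α}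
    (hg : g ∈ Subgroup.closure A) (h1 : norm g = 1) : g ∈ A := by
  rcases ReducedProduct.exists_of_mem_closure hA hg with rfl | ⟨y, hy⟩
  · simp at h1
  · rcases (hy.norm_aux hA).1 with rfl | h
    · exact hy.mem
    · omega

end Reduced

end FreeGroup

/-! ### The weight and its minimisers -/

namespace FreeGroup

section Weight

variable {α : Type*} [DecidableEq α] [Fintype α]

/-- A numerical code for words, injective on the words of a given length. -/
noncomputable def wordCode (l : List (α × Bool)) : ℕ :=
  Nat.ofDigits (Fintype.card (α × Bool) + 2) (l.map fun p => (Fintype.equivFin (α × Bool) p : ℕ))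

omit [DecidableEq α] in
theorem wordCode_append (l m : List (α × Bool)) :
    wordCode (l ++ m) = wordCode l + (Fintype.card (α × Bool) + 2) ^ l.length * wordCode m := by
  simp only [wordCode, List.map_append, Nat.ofDigits_append, List.length_map]

omit [DecidableEq α] in
theorem wordCode_inj {l m : List (α × Bool)} (hlen : l.length = m.length)
    (h : wordCode l = wordCode m) : l = m := by
  have hlt : ∀ l : List (α × Bool), ∀ d ∈ l.map fun p => (Fintype.equivFin (α × Bool) p : ℕ),
      d < Fintype.card (α × Bool) + 2 := by
    intro l d hd
    obtain ⟨p, -, rfl⟩ := List.mem_map.1 hd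
    exact (Fintype.equivFin (α × Bool) p).2.trans (by omega)
  -- The summand 2 in the base keeps it above 1 even over an empty alphabet.
  have := Nat.ofDigits_inj_of_len_eq (by omega) (by simpa using hlen) (hlt l) (hlt m) h
  refine List.map_injective_iff.2 (fun p q hpq => ?_) this
  exact (Fintype.equivFin (α × Bool)).injective (Fin.ext hpq)

/-- The sum of the codes of the initial halves of the reduced words of `x` and `x⁻¹`. -/
noncomputable def halfCode (x : FreeGroup α) : ℕ :=
  wordCode (x.toWord.take (norm x / 2)) + wordCode (x⁻¹.toWord.take (norm x / 2))

theorem halfCode_inv (x : FreeGroup α) : halfCode x⁻¹ = halfCode x := by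
  simp only [halfCode, norm_inv_eq, inv_inv, add_comm]

/-- Here `y * z` is `z` with its first `h` letters, the first half of `y⁻¹`, replaced by the first
half of `y`. The initial half of the inverse is untouched because `2 * h ≤ norm z`. -/
theorem halfCode_mul_add {y z : FreeGroup α} {h : ℕ} (hy : norm y = 2 * h)
    (hyz : gromovProduct y⁻¹ z = h) (hz : 2 * h ≤ norm z) :
    halfCode (y * z) + wordCode (y⁻¹.toWord.take h) =
      halfCode z + wordCode (y.toWord.take h) := by
  obtain ⟨c, a, b, h1, h2, hc, h3⟩ := exists_toWord_inv_mul y⁻¹ z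
  have hnorm := norm_mul_add y z
  have hny : norm y⁻¹ = c.length + a.length := by rw [norm, h1, List.length_append]
  have hnz : norm z = c.length + b.length := by rw [norm, h2, List.length_append]
  rw [norm_inv_eq] at hny
  have hcl : c.length = h := hc.trans hyz
  have hal : (invRev a).length = h := by rw [invRev_length]; omega
  have hyw : y.toWord = invRev a ++ invRev c := by
    rw [← invRev_append, ← h1, ← toWord_inv, inv_inv]
  have hzi : z⁻¹.toWord = invRev b ++ invRev c := by rw [toWord_inv, h2, invRev_append]
  rw [inv_inv] at h3
  have hyzi : (y * z)⁻¹.toWord = invRev b ++ a := by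
    rw [toWord_inv, h3, invRev_append, invRev_invRev]
  have hbl : norm z / 2 ≤ (invRev b).length := by rw [invRev_length]; omega
  have hm : norm (y * z) = norm z := by omega
  have htake : ∀ p : List (α × Bool), p.length = h →
      (p ++ b).take (norm z / 2) = p ++ b.take (norm z / 2 - h) := fun p hp => by
    rw [List.take_append, hp, List.take_of_length_le (by omega)]
  rw [halfCode, halfCode, hm, h3, hyzi, h2, hzi, htake _ hal, htake _ hcl,
    List.take_append_of_le_length hbl, List.take_append_of_le_length hbl, h1, hyw,
    List.take_left' hcl, List.take_left' hal, wordCode_append, wordCode_append, hal, hcl]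
  ring

/-- The weight minimised by Nielsen reduction: the length, with ties broken by `halfCode`. -/
noncomputable def nielsenWeight (x : FreeGroup α) : ℕ ×ₗ ℕ := toLex (norm x, halfCode x)

theorem nielsenWeight_inv (x : FreeGroup α) : nielsenWeight x⁻¹ = nielsenWeight x := by
  rw [nielsenWeight, nielsenWeight, norm_inv_eq, halfCode_inv]

theorem nielsenWeight_le_iff {x y : FreeGroup α} : nielsenWeight x ≤ nielsenWeight y ↔
    norm x < norm y ∨ norm x = norm y ∧ halfCode x ≤ halfCode y :=
  Prod.Lex.toLex_le_toLex

/-- The values of a map on the free generators, and their inverses. -/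
def signedValues {G : Type*} [Group G] (u : α → G) : Set G := {x | ∃ i, x = u i ∨ x = (u i)⁻¹}

/-- Length minimality gives everything except the case where exactly half of `y` cancels on each
side. There the tie-breakers for `y * z` and `y⁻¹ * x⁻¹` give opposite inequalities between the
codes of the first halves of `y` and `y⁻¹`. These halves then agree, which is impossible since `y⁻¹`
and `y` share less than half their letters. -/
theorem isNielsenReduced_signedValues {u : α → FreeGroup α} (hu : ∀ i, u i ≠ 1)
    (hmin : ∀ i j x y, i ≠ j → (x = u i ∨ x = (u i)⁻¹) → (y = u j ∨ y = (u j)⁻¹) →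
      nielsenWeight y ≤ nielsenWeight (x * y)) : IsNielsenReduced (signedValues u) := by
  have hone : ∀ x ∈ signedValues u, x ≠ 1 := by
    rintro _ ⟨i, rfl | rfl⟩
    exacts [hu i, inv_ne_one.2 (hu i)]
  have hinv : ∀ x ∈ signedValues u, x⁻¹ ∈ signedValues u := by
    rintro _ ⟨i, rfl | rfl⟩
    exacts [⟨i, Or.inr rfl⟩, ⟨i, Or.inl (inv_inv _)⟩]
  have hdich : ∀ x ∈ signedValues u, ∀ y ∈ signedValues u, x * y ≠ 1 →
      x = y ∨ nielsenWeight y ≤ nielsenWeight (x * y) := by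
    rintro x ⟨i, hx⟩ y ⟨j, hy⟩ hxy
    by_cases hij : i = j
    · subst hij
      rcases hx with rfl | rfl <;> rcases hy with rfl | rfl <;> simp at hxy ⊢
    · exact Or.inr (hmin i j x y hij hx hy)
  have hnorm : ∀ x ∈ signedValues u, ∀ y ∈ signedValues u, x * y ≠ 1 →
      norm y ≤ norm (x * y) := by
    intro x hx y hy hxy
    rcases hdich x hx y hy hxy with rfl | h
    · exact (norm_lt_norm_mul_self (hone x hx)).le
    · rcases nielsenWeight_le_iff.1 h with h | h
      exacts [h.le, h.1.le]
  refine ⟨hinv, hone, hnorm, fun x hx y hy z hz hxy hyz => ?_⟩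
  have hyx : y⁻¹ * x⁻¹ ≠ 1 := by rwa [← mul_inv_rev, inv_ne_one]
  have h1 := hnorm y hy z hz hyz
  have h2 := hnorm x hx y hy hxy
  have h3 := hnorm _ (hinv z hz) _ (hinv y hy) (by rwa [← mul_inv_rev, inv_ne_one])
  have h4 := hnorm _ (hinv y hy) _ (hinv x hx) hyx
  rw [← mul_inv_rev, norm_inv_eq, norm_inv_eq] at h3 h4
  have h5 := norm_mul_add x y
  have h6 := norm_mul_add y z
  by_contra hcon
  set h := gromovProduct y⁻¹ z with hh
  have hxh : gromovProduct x⁻¹ y = h := by omega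
  have hyh : norm y = 2 * h := by omega
  have hstrict := two_mul_gromovProduct_inv_self_lt (hone y hy)
  have hw1 : halfCode z ≤ halfCode (y * z) := by
    rcases hdich y hy z hz hyz with rfl | hw
    · omega
    · rcases nielsenWeight_le_iff.1 hw with hw | hw
      · omega
      · exact hw.2
  have hw2 : halfCode x⁻¹ ≤ halfCode (y⁻¹ * x⁻¹) := by
    rcases hdich _ (hinv y hy) _ (hinv x hx) hyx with hxy' | hw
    · rw [inv_inj] at hxy'
      subst hxy'
      omega
    · rw [nielsenWeight_le_iff, ← mul_inv_rev, norm_inv_eq, norm_inv_eq, mul_inv_rev] at hw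
      rcases hw with hw | hw
      · omega
      · exact hw.2
  have e1 := halfCode_mul_add hyh hh.symm (by omega)
  have e2 := halfCode_mul_add (y := y⁻¹) (z := x⁻¹) (h := h) (by rwa [norm_inv_eq])
    (by rw [inv_inv, gromovProduct_comm, hxh]) (by rw [norm_inv_eq]; omega)
  rw [inv_inv] at e2
  have hly : y.toWord.length = 2 * h := hyh
  have hlyi : y⁻¹.toWord.length = 2 * h := norm_inv_eq.trans hyh
  have heq : y.toWord.take h = y⁻¹.toWord.take h :=
    wordCode_inj (by rw [List.length_take, List.length_take, hly, hlyi]) (by omega)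
  have hp : y.toWord.take h <+: y⁻¹.toWord := heq ▸ List.take_prefix _ _
  have hle := hp.length_le_commonPrefixLength (List.take_prefix h y.toWord)
  rw [List.length_take, hly, ← gromovProduct] at hle
  omega

end Weight

/-! ### Elementary automorphisms -/

section Automorphisms

variable {α : Type*} [DecidableEq α]

omit [DecidableEq α] in
theorem mulAut_ext {f g : MulAut (FreeGroup α)} (h : ∀ k, f (of k) = g (of k)) : f = g :=
  MulEquiv.toMonoidHom_injective (ext_hom _ _ h)

/-- The endomorphism sending the generator `i` to `w` and fixing the other generators. -/
def updateHom (i : α) (w : FreeGroup α) : FreeGroup α →* FreeGroup α :=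
  lift (Function.update of i w)

theorem updateHom_of (i k : α) (w : FreeGroup α) :
    updateHom i w (of k) = if k = i then w else of k := by
  simp [updateHom, Function.update_apply]

/-- The automorphism inverting the generator `i` and fixing the other generators. -/
def signChange (i : α) : MulAut (FreeGroup α) :=
  MonoidHom.toMulEquiv (updateHom i (of i)⁻¹) (updateHom i (of i)⁻¹)
    (by ext k; by_cases h : k = i <;> simp [updateHom_of, h])
    (by ext k; by_cases h : k = i <;> simp [updateHom_of, h])

/-- The automorphism multiplying the generator `i` by the generator `j` on the right and fixing
the other generators. -/
def rightTransvection {i j : α} (h : i ≠ j) : MulAut (FreeGroup α) :=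
  MonoidHom.toMulEquiv (updateHom i (of i * of j)) (updateHom i (of i * (of j)⁻¹))
    (by ext k; by_cases hk : k = i <;> simp [updateHom_of, hk, h.symm])
    (by ext k; by_cases hk : k = i <;> simp [updateHom_of, hk, h.symm])

/-- The automorphism multiplying the generator `i` by the generator `j` on the left and fixing
the other generators. -/
def leftTransvection {i j : α} (h : i ≠ j) : MulAut (FreeGroup α) :=
  MonoidHom.toMulEquiv (updateHom i (of j * of i)) (updateHom i ((of j)⁻¹ * of i))
    (by ext k; by_cases hk : k = i <;> simp [updateHom_of, hk, h.symm])
    (by ext k; by_cases hk : k = i <;> simp [updateHom_of, hk, h.symm])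

/-- The automorphism permuting the generators by `σ`. -/
def permAut (σ : Equiv.Perm α) : MulAut (FreeGroup α) := freeGroupCongr σ

theorem signChange_of (i k : α) :
    signChange i (of k) = if k = i then (of i)⁻¹ else of k :=
  updateHom_of _ _ _

theorem rightTransvection_of {i j : α} (h : i ≠ j) (k : α) :
    rightTransvection h (of k) = if k = i then of i * of j else of k :=
  updateHom_of _ _ _

theorem rightTransvection_symm_of {i j : α} (h : i ≠ j) (k : α) :
    (rightTransvection h).symm (of k) = if k = i then of i * (of j)⁻¹ else of k :=
  updateHom_of _ _ _

theorem leftTransvection_of {i j : α} (h : i ≠ j) (k : α) :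
    leftTransvection h (of k) = if k = i then of j * of i else of k :=
  updateHom_of _ _ _

theorem leftTransvection_symm_of {i j : α} (h : i ≠ j) (k : α) :
    (leftTransvection h).symm (of k) = if k = i then (of j)⁻¹ * of i else of k :=
  updateHom_of _ _ _

omit [DecidableEq α] in
theorem permAut_of (σ : Equiv.Perm α) (k : α) : permAut σ (of k) = of (σ k) := by
  simp [permAut, freeGroupCongr]

omit [DecidableEq α] in
theorem permAut_mul (σ τ : Equiv.Perm α) : permAut (σ * τ) = permAut σ * permAut τ :=
  mulAut_ext fun k => by simp [permAut_of]

theorem signChange_mul_self (i : α) : signChange i * signChange i = 1 :=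
  mulAut_ext fun k => by by_cases h : k = i <;> simp [signChange_of, h]

theorem signChange_mul_rightTransvection_mul_signChange {i j : α} (h : i ≠ j) :
    signChange i * rightTransvection h * signChange i = (leftTransvection h)⁻¹ :=
  mulAut_ext fun k => by
    by_cases hk : k = i <;>
      simp [signChange_of, rightTransvection_of, leftTransvection_symm_of, hk, h.symm]

end Automorphisms

/-! ### Nielsen's theorem -/

section Generation

variable {α : Type*} [DecidableEq α] [Fintype α] {H : Subgroup (MulAut (FreeGroup α))}

theorem permAut_mem (hs : ∀ i j, i ≠ j → permAut (Equiv.swap i j) ∈ H) (σ : Equiv.Perm α) :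
    permAut σ ∈ H := by
  induction σ using Equiv.Perm.swap_induction_on with
  | one => convert H.one_mem; exact mulAut_ext fun k => by simp [permAut_of]
  | swap_mul f x y hxy ih => rw [permAut_mul]; exact H.mul_mem (hs x y hxy) ih

omit [Fintype α] in
theorem mem_of_apply_of_eq_or_inv [Finite α] (he : ∀ i, signChange i ∈ H)
    {θ : MulAut (FreeGroup α)} (hθ : ∀ k, θ (of k) = of k ∨ θ (of k) = (of k)⁻¹) : θ ∈ H := by
  have := Fintype.ofFinite α
  have key : ∀ (s : Finset α) (θ : MulAut (FreeGroup α)),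
      (∀ k, θ (of k) = if k ∈ s then (of k)⁻¹ else of k) → θ ∈ H := by
    intro s
    induction s using Finset.induction_on with
    | empty =>
      intro θ hθ
      have : θ = 1 := mulAut_ext fun k => by simp [hθ]
      exact this ▸ H.one_mem
    | insert i s hi ih =>
      intro θ hθ
      have h1 : θ * signChange i ∈ H := ih _ fun k => by
        by_cases hk : k = i <;> simp [signChange_of, hθ, hk, hi]
      rw [← mul_one θ, ← signChange_mul_self i, ← mul_assoc]
      exact H.mul_mem h1 (he i)
  classical
  refine key {k | θ (of k) ≠ of k} θ fun k => ?_
  by_cases hk : θ (of k) = of k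
  · simp [hk]
  · simpa [hk] using (hθ k).resolve_left hk

omit [Fintype α] in
theorem of_eq_of_or_inv_iff {k l : α} : (of k = of l ∨ of k = (of l)⁻¹) ↔ k = l := by
  constructor
  · rintro (h | h)
    · exact of_injective h
    · have := congrArg toWord h
      simp [toWord_inv, invRev] at this
  · rintro rfl
    exact Or.inl rfl

/-- The hypothesis makes `ψ⁻¹` a signed permutation: `f` is injective on a finite set, and undoing
it leaves only sign changes. -/
theorem mem_of_forall_of_mem_signedValues (he : ∀ i, signChange i ∈ H)
    (hs : ∀ i j, i ≠ j → permAut (Equiv.swap i j) ∈ H) {ψ : MulAut (FreeGroup α)}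
    (hψ : ∀ k, of k ∈ signedValues fun i => ψ (of i)) : ψ ∈ H := by
  choose f hf using hψ
  have hf' : ∀ k, ψ⁻¹ (of k) = of (f k) ∨ ψ⁻¹ (of k) = (of (f k))⁻¹ := fun k => by
    rcases hf k with h | h
    · exact Or.inl (by rw [h]; simp)
    · exact Or.inr (by rw [h]; simp)
  have hinj : Function.Injective f := fun k l hkl => by
    rw [← of_eq_of_or_inv_iff]
    have h1 := hf k
    have h2 := hf l
    rw [← hkl] at h2
    rcases h1 with h1 | h1 <;> rcases h2 with h2 | h2 <;> simp [h1, h2]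
  let σ : Equiv.Perm α := Equiv.ofBijective f (Finite.injective_iff_bijective.1 hinj)
  have hmem : ψ⁻¹ * permAut σ⁻¹ ∈ H := mem_of_apply_of_eq_or_inv he fun k => by
    rw [MulAut.mul_apply, permAut_of]
    have hσ : f (σ⁻¹ k) = k := σ.apply_symm_apply k
    have := hf' (σ⁻¹ k)
    rwa [hσ] at this
  rw [← inv_mem_iff]
  exact (Subgroup.mul_mem_cancel_right H (permAut_mem hs _)).1 hmem

omit [Fintype α] in
-- Precomposing with a transvection changes one member of the basis. The possible inversion of `x *
-- y` is harmless because the weight ignores it.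
theorem exists_nielsen_move (he : ∀ i, signChange i ∈ H)
    (hr : ∀ i j (h : i ≠ j), rightTransvection h ∈ H) {i j : α} (hij : i ≠ j)
    (ψ : MulAut (FreeGroup α)) {x y : FreeGroup α} (hx : x = ψ (of i) ∨ x = (ψ (of i))⁻¹)
    (hy : y = ψ (of j) ∨ y = (ψ (of j))⁻¹) :
    ∃ τ ∈ H, (∀ k, k ≠ j → (ψ * τ) (of k) = ψ (of k)) ∧
      ((ψ * τ) (of j) = x * y ∨ (ψ * τ) (of j) = (x * y)⁻¹) := by
  have hl : leftTransvection hij.symm ∈ H := by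
    rw [← inv_mem_iff, ← signChange_mul_rightTransvection_mul_signChange]
    exact H.mul_mem (H.mul_mem (he _) (hr _ _ _)) (he _)
  have hr' := hr j i hij.symm
  rcases hx with rfl | rfl <;> rcases hy with rfl | rfl
  · exact ⟨_, hl, fun k hk => by simp [leftTransvection_of, hk], by simp [leftTransvection_of]⟩
  · exact ⟨_, H.inv_mem hr', fun k hk => by simp [rightTransvection_symm_of, hk, -map_inv],
      by simp [rightTransvection_symm_of]⟩
  · exact ⟨_, H.inv_mem hl, fun k hk => by simp [leftTransvection_symm_of, hk],
      by simp [leftTransvection_symm_of]⟩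
  · exact ⟨_, hr', fun k hk => by simp [rightTransvection_of, hk],
      by simp [rightTransvection_of]⟩

/-- **Nielsen's theorem**: the automorphism group of a free group of finite rank is generated by
the sign changes, the permutations of the generators, and the transvections. -/
theorem subgroup_mulAut_eq_top (he : ∀ i, signChange i ∈ H)
    (hs : ∀ i j, i ≠ j → permAut (Equiv.swap i j) ∈ H)
    (hr : ∀ i j (h : i ≠ j), rightTransvection h ∈ H) : H = ⊤ := by
  rw [eq_top_iff]
  intro φ _
  -- Total weight of the basis, minimised over the coset `φH`. A move alters one summand, so
  -- minimality of the sum passes to that summand by cancellation.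
  let W : H → ℕ ×ₗ ℕ := fun τ => ∑ k, nielsenWeight ((φ * τ : MulAut (FreeGroup α)) (of k))
  obtain ⟨τ, hτ⟩ : ∃ τ, ∀ τ', W τ ≤ W τ' :=
    ⟨Function.argmin W, fun τ' => Function.argmin_le W τ'⟩
  set ψ : MulAut (FreeGroup α) := φ * τ with hψ
  have hred : IsNielsenReduced (signedValues fun i => ψ (of i)) := by
    refine isNielsenReduced_signedValues (fun i => by simp) fun i j x y hij hx hy => ?_
    obtain ⟨ρ, hρ, hρ1, hρ2⟩ := exists_nielsen_move he hr hij ψ hx hy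
    have hle := hτ (τ * ⟨ρ, hρ⟩)
    have hWρ : W (τ * ⟨ρ, hρ⟩) = ∑ k, nielsenWeight ((ψ * ρ) (of k)) := by
      simp only [W, hψ, Subgroup.coe_mul, mul_assoc]
    have hy' : nielsenWeight (ψ (of j)) = nielsenWeight y := by
      rcases hy with rfl | rfl
      exacts [rfl, (nielsenWeight_inv _).symm]
    have hxy' : nielsenWeight ((ψ * ρ) (of j)) = nielsenWeight (x * y) := by
      rcases hρ2 with h | h
      · rw [h]
      · rw [h, nielsenWeight_inv]
    rw [hWρ, ← Finset.add_sum_erase _ _ (Finset.mem_univ j),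
      Finset.sum_congr rfl fun k hk => by rw [hρ1 k (Finset.ne_of_mem_erase hk)], hxy'] at hle
    have hWτ : W τ = nielsenWeight y +
        ∑ k ∈ Finset.univ.erase j, nielsenWeight (ψ (of k)) := by
      rw [← hy', Finset.add_sum_erase _ (fun k => nielsenWeight (ψ (of k))) (Finset.mem_univ j)]
    rw [hWτ] at hle
    exact le_of_add_le_add_right hle
  have hclosure : Subgroup.closure (signedValues fun i => ψ (of i)) = ⊤ := by
    have hsurj : Function.Surjective ψ.toMonoidHom := ψ.surjective
    rw [eq_top_iff, ← MonoidHom.range_eq_top.2 hsurj, MonoidHom.range_eq_map,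
      ← closure_range_of, MonoidHom.map_closure, Subgroup.closure_le]
    rintro _ ⟨_, ⟨i, rfl⟩, rfl⟩
    exact Subgroup.subset_closure ⟨i, Or.inl rfl⟩
  have hψH : ψ ∈ H := mem_of_forall_of_mem_signedValues he hs fun k =>
    hred.mem_of_norm_eq_one (hclosure ▸ Subgroup.mem_top _) (norm_of k)
  exact (Subgroup.mul_mem_cancel_right H τ.2).1 hψH

end Generation

end FreeGroup

/-! ### Relations between elementary automorphisms, and rigidity -/

namespace FreeGroup

section Relations

variable {α : Type*} [DecidableEq α] {i j k : α}

theorem commute_signChange (i j : α) : Commute (signChange i) (signChange j) :=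
  mulAut_ext fun l => by
    by_cases hi : l = i <;> by_cases hj : l = j <;> simp [signChange_of, hi, hj]
    all_goals (try split_ifs) <;> simp_all [signChange_of]

theorem permAut_swap_mul_signChange (i j : α) :
    permAut (Equiv.swap i j) * signChange i = signChange j * permAut (Equiv.swap i j) :=
  mulAut_ext fun l => by
    by_cases hl : l = i
    · simp [hl, signChange_of, permAut_of]
    · have : Equiv.swap i j l ≠ j := by
        rw [Ne, Equiv.swap_apply_eq_iff, Equiv.swap_apply_right]
        exact hl
      simp [hl, signChange_of, permAut_of, this]

theorem commute_signChange_rightTransvection (hij : i ≠ j) (hki : k ≠ i) (hkj : k ≠ j) :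
    Commute (signChange k) (rightTransvection hij) :=
  mulAut_ext fun l => by
    by_cases hi : l = i <;> by_cases hk : l = k <;>
      simp_all [signChange_of, rightTransvection_of, hki.symm, hkj.symm]

theorem signChange_mul_rightTransvection_mul_signChange_right (h : i ≠ j) :
    signChange j * rightTransvection h * signChange j = (rightTransvection h)⁻¹ :=
  mulAut_ext fun l => by
    by_cases hi : l = i <;> by_cases hj : l = j <;>
      simp_all [signChange_of, rightTransvection_of, rightTransvection_symm_of, h.symm]

theorem commute_leftTransvection_rightTransvection (hij : i ≠ j) (hik : i ≠ k) :
    Commute (leftTransvection hij) (rightTransvection hik) :=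
  mulAut_ext fun l => by
    by_cases hi : l = i <;>
      simp [leftTransvection_of, rightTransvection_of, hi, hij.symm, hik.symm, mul_assoc]

theorem commute_rightTransvection_rightTransvection (hij : i ≠ j) (hik : i ≠ k) (hjk : j ≠ k) :
    Commute (rightTransvection hik) (rightTransvection hjk) :=
  mulAut_ext fun l => by
    by_cases hi : l = i <;> by_cases hj : l = j <;>
      simp_all [rightTransvection_of, hij.symm, hik.symm, hjk.symm]

theorem rightTransvection_mul_rightTransvection (hij : i ≠ j) (hik : i ≠ k) (hjk : j ≠ k) :
    rightTransvection hjk * rightTransvection hij =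
      rightTransvection hij * rightTransvection hik * rightTransvection hjk :=
  mulAut_ext fun l => by
    by_cases hi : l = i <;> by_cases hj : l = j <;>
      simp_all [rightTransvection_of, hij.symm, hik.symm, mul_assoc]

/-- The analogue of writing a Weyl element as a product of three elementary matrices; it carries the
triviality of transvections over to swaps. -/
theorem rightTransvection_mul_leftTransvection (h : i ≠ j) :
    rightTransvection h * (rightTransvection h.symm)⁻¹ * leftTransvection h =
      permAut (Equiv.swap i j) * signChange j :=
  mulAut_ext fun l => by
    by_cases hi : l = i <;> by_cases hj : l = j <;>
      simp_all [rightTransvection_of, rightTransvection_symm_of, leftTransvection_of, permAut_of,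
        signChange_of, h.symm, Equiv.swap_apply_of_ne_of_ne]

end Relations

section Rigidity

variable {α K : Type*} [DecidableEq α] [Group K] {i j k : α}

/-- The two images are commuting involutions, and conjugacy by a swap makes one trivial when the
other is. -/
theorem map_signChange_eq (hK : CommutingInvolutionsAgree K) (φ : MulAut (FreeGroup α) →* K)
    (i j : α) : φ (signChange i) = φ (signChange j) := by
  have hsq : ∀ l : α, φ (signChange l) * φ (signChange l) = 1 := fun l => by
    rw [← _root_.map_mul, signChange_mul_self, _root_.map_one]
  have hone : ∀ l m : α, φ (signChange l) = 1 → φ (signChange m) = 1 := fun l m hl => by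
    have h := congrArg φ (permAut_swap_mul_signChange l m)
    rw [_root_.map_mul, _root_.map_mul, hl, mul_one] at h
    exact right_eq_mul.1 h
  rcases hK _ _ (hsq i) (hsq j) ((commute_signChange i j).map φ) with h | h | h
  · rw [h, hone i j h]
  · rw [h, hone j i h]
  · exact h

/-- The sign changes at `i`, `j`, `k` have one common image. The one at `k` commutes with the
transvection, the one at `j` inverts it, and the one at `i` turns it into the inverse left
transvection. -/
theorem map_rightTransvection_mul_self (hK : CommutingInvolutionsAgree K)
    (φ : MulAut (FreeGroup α) →* K) (hij : i ≠ j) (hki : k ≠ i) (hkj : k ≠ j) :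
    φ (rightTransvection hij) * φ (rightTransvection hij) = 1 ∧
      φ (leftTransvection hij) = φ (rightTransvection hij) := by
  have hcomm : Commute (φ (signChange k)) (φ (rightTransvection hij)) :=
    (commute_signChange_rightTransvection hij hki hkj).map φ
  have hsq : φ (signChange k) * φ (signChange k) = 1 := by
    rw [← _root_.map_mul, signChange_mul_self, _root_.map_one]
  have hconj : φ (signChange k) * φ (rightTransvection hij) * φ (signChange k) =
      φ (rightTransvection hij) := by rw [hcomm.eq, mul_assoc, hsq, mul_one]
  have h1 := congrArg φ (signChange_mul_rightTransvection_mul_signChange_right hij)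
  have h2 := congrArg φ (signChange_mul_rightTransvection_mul_signChange hij)
  rw [_root_.map_mul, _root_.map_mul, _root_.map_inv, map_signChange_eq hK φ _ k, hconj] at h1 h2
  exact ⟨mul_eq_one_iff_eq_inv.2 h1, inv_injective (h2.symm.trans h1)⟩

theorem map_rightTransvection_eq_one (hK : CommutingInvolutionsAgree K)
    (φ : MulAut (FreeGroup α) →* K) (hij : i ≠ j) (hik : i ≠ k) (hjk : j ≠ k) :
    φ (rightTransvection hik) = 1 := by
  obtain ⟨hsq1, hl1⟩ := map_rightTransvection_mul_self hK φ hij hik.symm hjk.symm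
  obtain ⟨hsq2, -⟩ := map_rightTransvection_mul_self hK φ hik hij.symm hjk
  obtain ⟨hsq3, -⟩ := map_rightTransvection_mul_self hK φ hjk hij hik
  have hrel := congrArg φ (rightTransvection_mul_rightTransvection hij hik hjk)
  simp only [_root_.map_mul] at hrel
  -- Left and right transvections have the same image, so the images of the two right transvections
  -- of `i` commute.
  have hc1 := (commute_leftTransvection_rightTransvection hij hik).map φ
  rw [hl1] at hc1
  have hc2 := (commute_rightTransvection_rightTransvection hij hik hjk).map φ
  rcases hK _ _ hsq1 hsq2 hc1 with h | h | h
  · simpa [h] using hrel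
  · exact h
  · rcases hK _ _ hsq2 hsq3 hc2 with h' | h' | h'
    · exact h'
    · simpa [h'] using hrel
    -- All three images equal one involution `r`, and the relation reads `r² = r³`.
    · rw [h, h', hsq3, one_mul] at hrel
      rw [h', ← hrel]

theorem map_permAut_swap (hK : CommutingInvolutionsAgree K) (φ : MulAut (FreeGroup α) →* K)
    (hij : i ≠ j) (hik : i ≠ k) (hjk : j ≠ k) :
    φ (permAut (Equiv.swap i j)) = φ (signChange j) := by
  have h := congrArg φ (rightTransvection_mul_leftTransvection hij)
  have hl := (map_rightTransvection_mul_self hK φ hij hik.symm hjk.symm).2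
  rw [_root_.map_mul, _root_.map_mul, _root_.map_mul, _root_.map_inv, hl,
    map_rightTransvection_eq_one hK φ hik hij hjk.symm,
    map_rightTransvection_eq_one hK φ hjk hij.symm hik.symm, inv_one, one_mul, one_mul] at h
  rw [eq_comm, mul_eq_one_iff_eq_inv] at h
  rw [h, inv_eq_iff_mul_eq_one, ← _root_.map_mul, signChange_mul_self, _root_.map_one]

theorem exists_forall_map_eq_one_or_eq [Fintype α] (hα : 3 ≤ Fintype.card α)
    (hK : CommutingInvolutionsAgree K) (φ : MulAut (FreeGroup α) →* K) :
    ∃ ε : K, ε * ε = 1 ∧ ∀ g, φ g = 1 ∨ φ g = ε := by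
  have hthird : ∀ i j : α, ∃ k, i ≠ k ∧ j ≠ k := fun i j => by
    obtain ⟨k, hk⟩ : ∃ k, k ∉ ({i, j} : Finset α) := by
      by_contra! h
      have := (Finset.card_le_card (fun k _ => h k : Finset.univ ⊆ {i, j})).trans
        Finset.card_le_two
      rw [Finset.card_univ] at this
      omega
    simp only [Finset.mem_insert, Finset.mem_singleton, not_or] at hk
    exact ⟨k, Ne.symm hk.1, Ne.symm hk.2⟩
  obtain ⟨i₀⟩ : Nonempty α := Fintype.card_pos_iff.1 (by omega)
  have hε : φ (signChange i₀) * φ (signChange i₀) = 1 := by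
    rw [← _root_.map_mul, signChange_mul_self, _root_.map_one]
  have htop : (Subgroup.zpowers (φ (signChange i₀))).comap φ = ⊤ := by
    refine subgroup_mulAut_eq_top (fun i => ?_) (fun i j hij => ?_) (fun i j hij => ?_)
    · rw [Subgroup.mem_comap, map_signChange_eq hK φ i i₀]
      exact Subgroup.mem_zpowers _
    · obtain ⟨k, hik, hjk⟩ := hthird i j
      rw [Subgroup.mem_comap, map_permAut_swap hK φ hij hik hjk, map_signChange_eq hK φ j i₀]
      exact Subgroup.mem_zpowers _
    · obtain ⟨k, hik, hjk⟩ := hthird i j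
      rw [Subgroup.mem_comap, map_rightTransvection_eq_one hK φ hik hij hjk.symm]
      exact Subgroup.one_mem _
  refine ⟨_, hε, fun g => ?_⟩
  obtain ⟨m, hm⟩ : φ g ∈ Subgroup.zpowers (φ (signChange i₀)) :=
    Subgroup.mem_comap.1 (htop ▸ Subgroup.mem_top g)
  rw [← hm]
  obtain ⟨l, rfl⟩ | ⟨l, rfl⟩ := Int.even_or_odd m
  · left
    simp only [zpow_add, ← (Commute.refl _).mul_zpow, hε, one_zpow]
  · right
    simp only [zpow_add_one, zpow_mul, zpow_ofNat, pow_two, hε, one_zpow, one_mul]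

end Rigidity

end FreeGroup

/-! ### From two-valued homomorphisms to the theorem -/

theorem factorsThroughZModTwo_of_forall_eq_one_or_eq {G K : Type*} [Group G] [Group K]
    {φ : G →* K} {ε : K} (hε : ε * ε = 1) (hφ : ∀ g, φ g = 1 ∨ φ g = ε) :
    FactorsThroughZModTwo φ := by
  classical
  have hZ : ∀ x : Multiplicative (ZMod 2), x = 1 ∨ x = Multiplicative.ofAdd 1 := by decide
  have hne : (Multiplicative.ofAdd 1 : Multiplicative (ZMod 2)) ≠ 1 := by decide
  have hsq : (Multiplicative.ofAdd 1 * Multiplicative.ofAdd 1 : Multiplicative (ZMod 2)) = 1 := by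
    decide
  -- `π` records whether `φ g` is nontrivial; if `ε = 1` it is the trivial map.
  refine ⟨MonoidHom.mk' (fun g => if φ g = 1 then 1 else Multiplicative.ofAdd 1) fun g h => ?_,
    MonoidHom.mk' (fun x => if x = 1 then 1 else ε) fun x y => ?_, ?_⟩
  · by_cases hg : φ g = 1
    · simp [hg]
    · by_cases hh : φ h = 1
      · simp [hg, hh]
      · rw [map_mul, if_pos, if_neg hg, if_neg hh, hsq]
        rw [(hφ g).resolve_left hg, (hφ h).resolve_left hh, hε]
  · rcases hZ x with rfl | rfl <;> rcases hZ y with rfl | rfl <;> simp [hne, hsq, hε]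
  · ext1 g
    by_cases hg : φ g = 1
    · simp [hg]
    · simpa [hg, hne] using (hφ g).resolve_left hg

theorem theorem1p3 (n : ℕ) (hn : 6 ≤ n) :
    (∀ φ : MulAut (FreeGroup (Fin n)) →* DiffCircle 2, FactorsThroughZModTwo φ) ∧
    (∀ φ : MulAut (FreeGroup (Fin n)) →* DiffInterval 2, φ = 1) ∧
    (∀ φ : OutAut (FreeGroup (Fin n)) →* DiffCircle 2, FactorsThroughZModTwo φ) ∧
    (∀ φ : OutAut (FreeGroup (Fin n)) →* DiffInterval 2, φ = 1) := by
  have hcard : 3 ≤ Fintype.card (Fin n) := by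
    rw [Fintype.card_fin]
    omega
  have hinterval : ∀ φ : MulAut (FreeGroup (Fin n)) →* DiffInterval 2, φ = 1 := fun φ => by
    obtain ⟨ε, hε, hφ⟩ := FreeGroup.exists_forall_map_eq_one_or_eq hcard
      (commutingInvolutionsAgree_diffInterval 2) φ
    ext1 g
    exact (hφ g).elim id fun h => h.trans (DiffInterval.eq_one_of_mul_self hε)
  refine ⟨fun φ => ?_, hinterval, fun φ => ?_, fun φ => ?_⟩
  · obtain ⟨ε, hε, hφ⟩ := FreeGroup.exists_forall_map_eq_one_or_eq hcard
      (commutingInvolutionsAgree_diffCircle 2) φ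
    exact factorsThroughZModTwo_of_forall_eq_one_or_eq hε hφ
  -- Being two-valued descends from `Aut` to `Out`, since the quotient map is surjective.
  · obtain ⟨ε, hε, hφ⟩ := FreeGroup.exists_forall_map_eq_one_or_eq hcard
      (commutingInvolutionsAgree_diffCircle 2) (φ.comp (QuotientGroup.mk' _))
    exact factorsThroughZModTwo_of_forall_eq_one_or_eq hε
      ((QuotientGroup.mk'_surjective _).forall.2 hφ)
  · exact (MonoidHom.cancel_right (QuotientGroup.mk'_surjective _)).1
      (hinterval (φ.comp (QuotientGroup.mk' _)))
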